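/- Let $m,p$ be non-negative integers and let $G$ belong to the Wiener space $\mathcal W_+^{m\times p}$, that is, $G$ is an $m\times p$ matrix function on the unit circle $\mathbb T$ of the form $$G(z)=\sum_{\nu=0}^{\infty} z^\nu G_\nu\quad(z\in\mathbb T),\qquad \sum_{\nu=0}^\infty\|G_\nu\|<\infty,$$ with $G_\nu\in\mathbb C^{m\times p}$. Let $T_G:\ell^2_+(\mathbb C^p)\to\ell^2_+(\mathbb C^m)$ be the bounded analytic Toeplitz operator $$(T_Gx)_i=\sum_{j=0}^{i}G_{i-j}\,x_j\qquad(i=0,1,2,\ldots).$$ Assume that $T_GT_G^*$ is strictly positive, i.e., non-negative and boundedly invertible on $\ell^2_+(\mathbb C^m)$. Then $(T_GT_G^*)^{-1}$ maps $$\ell^1_+(\mathbb C^m)=\Big\{x=(x_n)_{n\ge0}:\ \sum_{n\ge0}\|x_n\|<\infty\Big\}$$ (seen as a linear submanifold of $\ell^2_+(\mathbb C^m)$) into itself. -/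

import Mathlib

open scoped ENNReal Matrix.Norms.L2Operator InnerProductSpace

noncomputable section

namespace WienerBezout

/-- `ℓ²₊(ℂˢ)`: the Hilbert space of one-sided square summable sequences in `ℂˢ`. -/
abbrev EllTwo (s : ℕ) : Type := lp (fun _ : ℕ => EuclideanSpace ℂ (Fin s)) 2

/-- `ℓ¹₊(ℂˢ)`, seen as a linear submanifold of `ℓ²₊(ℂˢ)`: the sequences `x` with
`∑ ‖x n‖ < ∞`. -/
def ellOne (s : ℕ) : Set (EllTwo s) := {x | Memℓp (fun n => x n) 1}

/-- The class `W₊^{r×s}`: matrix functions `F` on the unit circle of the form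
`F z = ∑_{ν ≥ 0} z ^ ν F_ν` with `∑ ‖F_ν‖ < ∞` (the norm on matrices is the operator norm). -/
def MemWienerPlus {r s : ℕ} (F : Circle → Matrix (Fin r) (Fin s) ℂ) : Prop :=
  ∃ c : ℕ → Matrix (Fin r) (Fin s) ℂ, Summable (fun ν => ‖c ν‖) ∧
    ∀ z : Circle, HasSum (fun ν : ℕ => (z : ℂ) ^ ν • c ν) (F z)

/-- The `ν`-th Fourier coefficient `∫₀¹ e^{-2πiνt} F(e^{2πit}) dt` of a matrix function `F` on the
unit circle. -/
def fourierMatrix {r s : ℕ} (F : Circle → Matrix (Fin r) (Fin s) ℂ) (ν : ℤ) :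
    Matrix (Fin r) (Fin s) ℂ :=
  fourierCoeff (fun t : UnitAddCircle => F (AddCircle.toCircle t)) ν

/-- The coefficients in a Wiener expansion are the Fourier coefficients. -/
theorem fourierMatrix_eq {r s : ℕ} {F : Circle → Matrix (Fin r) (Fin s) ℂ}
    {c : ℕ → Matrix (Fin r) (Fin s) ℂ} (hc : Summable (fun ν => ‖c ν‖))
    (hF : ∀ z : Circle, HasSum (fun ν : ℕ => (z : ℂ) ^ ν • c ν) (F z)) (k : ℕ) :
    fourierMatrix F k = c k := by
  have hpt : ∀ (n : ℕ) (t : UnitAddCircle),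
      fourier (-(k : ℤ)) t • ((AddCircle.toCircle t : ℂ) ^ n • c n)
        = fourier ((n : ℤ) - k) t • c n := by
    intro n t
    rw [smul_smul, sub_eq_add_neg, add_comm, fourier_add]
    congr 2
    rw [fourier_apply, AddCircle.toCircle_zsmul]
    simp
  have hint : ∀ n : ℤ, ∫ t : UnitAddCircle, fourier n t ∂AddCircle.haarAddCircle
      = if n = 0 then 1 else 0 := by
    intro n
    have h := fourierCoeff_fourier (T := (1 : ℝ)) n
    have h0 := congrFun h 0
    simp only [fourierCoeff, neg_zero, fourier_zero, one_smul] at h0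
    rw [h0, Pi.single_apply]
    simp [eq_comm]
  have hnorm : ∀ (n : ℕ) (t : UnitAddCircle),
      ‖fourier ((n : ℤ) - k) t • c n‖ = ‖c n‖ := by
    intro n t
    rw [norm_smul, fourier_apply, Circle.norm_coe, one_mul]
  have hsum := MeasureTheory.hasSum_integral_of_summable_integral_norm
    (μ := AddCircle.haarAddCircle (T := (1 : ℝ)))
    (F := fun (n : ℕ) (t : UnitAddCircle) => fourier ((n : ℤ) - k) t • c n)
    (fun n => (((map_continuous (fourier _)).smul continuous_const).integrable_of_hasCompactSupport
      (HasCompactSupport.of_compactSpace _)))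
    (by simpa [hnorm, -fourier_apply] using hc)
  have hlhs : fourierMatrix F k = ∫ t : UnitAddCircle,
      (∑' n : ℕ, fourier ((n : ℤ) - k) t • c n) ∂AddCircle.haarAddCircle := by
    unfold fourierMatrix fourierCoeff
    congr 1
    funext t
    rw [← ((hF (AddCircle.toCircle t)).const_smul (fourier (-(k : ℤ)) t)).tsum_eq]
    exact tsum_congr fun n => hpt n t
  rw [hlhs, ← hsum.tsum_eq, tsum_eq_single k]
  · rw [integral_smul_const, hint]; simp
  · intro n hn
    rw [integral_smul_const, hint, if_neg (by omega), zero_smul]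

theorem MemWienerPlus.summable {r s : ℕ} {F : Circle → Matrix (Fin r) (Fin s) ℂ}
    (hF : MemWienerPlus F) : Summable (fun ν : ℕ => ‖fourierMatrix F ν‖) := by
  obtain ⟨c, hc, h⟩ := hF
  simpa only [fourierMatrix_eq hc h] using hc

/-- Row `i` of the block lower triangular Toeplitz matrix with first column `c₀, c₁, …`, applied
to the sequence `x`: the vector `∑_{j ≤ i} c_{i-j} x_j`. -/
def toeplitzRow {r s : ℕ} (c : ℕ → Matrix (Fin r) (Fin s) ℂ) (x : ℕ → EuclideanSpace ℂ (Fin s))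
    (i : ℕ) : EuclideanSpace ℂ (Fin r) :=
  ∑ j ∈ Finset.range (i + 1), Matrix.toEuclideanLin (c (i - j)) (x j)

theorem norm_toEuclideanLin_le {r s : ℕ} (A : Matrix (Fin r) (Fin s) ℂ)
    (y : EuclideanSpace ℂ (Fin s)) : ‖Matrix.toEuclideanLin A y‖ ≤ ‖A‖ * ‖y‖ :=
  (Matrix.toEuclideanLin.trans LinearMap.toContinuousLinearMap A).le_opNorm y

/-- Discrete Young inequality `‖a * b‖₂ ≤ ‖a‖₁ ‖b‖₂` for finite sections. -/
theorem sum_conv_sq_le {a b : ℕ → ℝ} (ha : ∀ k, 0 ≤ a k) {A B : ℝ}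
    (hA : ∀ N, ∑ k ∈ Finset.range N, a k ≤ A)
    (hB : ∀ N, ∑ k ∈ Finset.range N, b k ^ 2 ≤ B ^ 2) (N : ℕ) :
    ∑ i ∈ Finset.range N, (∑ j ∈ Finset.range (i + 1), a (i - j) * b j) ^ 2 ≤ (A * B) ^ 2 := by
  have hA0 : 0 ≤ A := by simpa using hA 0
  have hrow : ∀ i, (∑ j ∈ Finset.range (i + 1), a (i - j) * b j) ^ 2
      ≤ A * ∑ j ∈ Finset.range (i + 1), a (i - j) * b j ^ 2 := by
    intro i
    have h2 : (∑ j ∈ Finset.range (i + 1), a (i - j) * b j) ^ 2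
        ≤ (∑ j ∈ Finset.range (i + 1), a (i - j))
          * ∑ j ∈ Finset.range (i + 1), a (i - j) * b j ^ 2 :=
      Finset.sum_sq_le_sum_mul_sum_of_sq_le_mul _ (fun j _ => ha (i - j))
        (fun j _ => mul_nonneg (ha (i - j)) (sq_nonneg (b j)))
        (fun j _ => le_of_eq (by ring))
    have h3 : ∑ j ∈ Finset.range (i + 1), a (i - j) ≤ A := by
      have := Finset.sum_range_reflect a (i + 1)
      simp only [Nat.add_sub_cancel] at this
      rw [this]
      exact hA _
    exact h2.trans (mul_le_mul_of_nonneg_right h3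
      (Finset.sum_nonneg fun j _ => mul_nonneg (ha _) (sq_nonneg _)))
  have hswap : ∑ i ∈ Finset.range N, ∑ j ∈ Finset.range (i + 1), a (i - j) * b j ^ 2
      = ∑ j ∈ Finset.range N, ∑ i ∈ Finset.Ico j N, a (i - j) * b j ^ 2 := by
    apply Finset.sum_comm'
    intro i j
    simp only [Finset.mem_range, Finset.mem_Ico]
    omega
  have hcols : ∑ j ∈ Finset.range N, ∑ i ∈ Finset.Ico j N, a (i - j) * b j ^ 2
      ≤ A * B ^ 2 := by
    refine (Finset.sum_le_sum (g := fun j => A * b j ^ 2) fun j _ => ?_).trans ?_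
    · rw [← Finset.sum_mul, Finset.sum_Ico_eq_sum_range]
      simp only [Nat.add_sub_cancel_left]
      exact mul_le_mul_of_nonneg_right (hA _) (sq_nonneg _)
    · rw [← Finset.mul_sum]
      exact mul_le_mul_of_nonneg_left (hB N) hA0
  calc ∑ i ∈ Finset.range N, (∑ j ∈ Finset.range (i + 1), a (i - j) * b j) ^ 2
      ≤ ∑ i ∈ Finset.range N, A * ∑ j ∈ Finset.range (i + 1), a (i - j) * b j ^ 2 :=
        Finset.sum_le_sum fun i _ => hrow i
    _ ≤ A * (A * B ^ 2) := by
        rw [← Finset.mul_sum, hswap]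
        exact mul_le_mul_of_nonneg_left hcols hA0
    _ = (A * B) ^ 2 := by ring

theorem sum_toeplitzRow_sq_le {r s : ℕ} {c : ℕ → Matrix (Fin r) (Fin s) ℂ}
    (hc : Summable (fun ν => ‖c ν‖)) (x : EllTwo s) (t : Finset ℕ) :
    ∑ i ∈ t, ‖toeplitzRow c (fun n => x n) i‖ ^ (2 : ℝ≥0∞).toReal
      ≤ ((∑' ν, ‖c ν‖) * ‖x‖) ^ (2 : ℝ≥0∞).toReal := by
  have hx : ∀ N : ℕ, ∑ j ∈ Finset.range N, ‖x j‖ ^ 2 ≤ ‖x‖ ^ 2 := by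
    intro N
    have h := lp.sum_rpow_le_norm_rpow (p := 2) (by simp) x (Finset.range N)
    simpa only [ENNReal.toReal_ofNat, Real.rpow_ofNat] using h
  have hrow : ∀ i, ‖toeplitzRow c (fun n => x n) i‖ ^ 2
      ≤ (∑ j ∈ Finset.range (i + 1), ‖c (i - j)‖ * ‖x j‖) ^ 2 := fun i =>
    pow_le_pow_left₀ (norm_nonneg _) ((norm_sum_le _ _).trans
      (Finset.sum_le_sum fun j _ => norm_toEuclideanLin_le (c (i - j)) (x j))) 2
  obtain ⟨N, hN⟩ := t.exists_nat_subset_range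
  have hmain := sum_conv_sq_le (a := fun k => ‖c k‖) (b := fun k => ‖x k‖)
    (fun k => norm_nonneg (c k))
    (fun N => hc.sum_le_tsum (Finset.range N) fun k _ => norm_nonneg (c k)) hx N
  simp only [ENNReal.toReal_ofNat, Real.rpow_ofNat]
  refine (Finset.sum_le_sum fun i _ => hrow i).trans
    ((Finset.sum_le_sum_of_subset_of_nonneg hN fun i _ _ => sq_nonneg _).trans hmain)

theorem memℓp_toeplitzRow {r s : ℕ} {c : ℕ → Matrix (Fin r) (Fin s) ℂ}
    (hc : Summable (fun ν => ‖c ν‖)) (x : EllTwo s) :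
    Memℓp (toeplitzRow c (fun n => x n)) 2 :=
  memℓp_gen' (sum_toeplitzRow_sq_le hc x)

/-- The linear map on `ℓ²₊` given by the block lower triangular Toeplitz matrix with first column
`c₀, c₁, …`. -/
def toeplitzLin {r s : ℕ} (c : ℕ → Matrix (Fin r) (Fin s) ℂ) (hc : Summable (fun ν => ‖c ν‖)) :
    EllTwo s →ₗ[ℂ] EllTwo r where
  toFun x := ⟨toeplitzRow c (fun n => x n), memℓp_toeplitzRow hc x⟩
  map_add' x y := by
    apply lp.ext
    funext i
    change toeplitzRow c (fun n => x n + y n) i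
      = toeplitzRow c (fun n => x n) i + toeplitzRow c (fun n => y n) i
    simp only [toeplitzRow, map_add, Finset.sum_add_distrib]
  map_smul' z x := by
    apply lp.ext
    funext i
    change toeplitzRow c (fun n => z • x n) i = z • toeplitzRow c (fun n => x n) i
    simp only [toeplitzRow, map_smul, Finset.smul_sum]

theorem norm_toeplitzLin_le {r s : ℕ} {c : ℕ → Matrix (Fin r) (Fin s) ℂ}
    (hc : Summable (fun ν => ‖c ν‖)) (x : EllTwo s) :
    ‖toeplitzLin c hc x‖ ≤ (∑' ν, ‖c ν‖) * ‖x‖ :=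
  lp.norm_le_of_forall_sum_le (by simp)
    (mul_nonneg (tsum_nonneg fun _ => norm_nonneg _) (norm_nonneg _))
    (sum_toeplitzRow_sq_le hc x)

/-- The analytic Toeplitz operator `T_F : ℓ²₊(ℂˢ) → ℓ²₊(ℂʳ)` of `F ∈ W₊^{r×s}`, given by the block
lower triangular Toeplitz matrix `[F_{i-j}]_{0 ≤ j ≤ i}` of the Fourier coefficients of `F`. -/
def toeplitz {r s : ℕ} (F : Circle → Matrix (Fin r) (Fin s) ℂ) (hF : MemWienerPlus F) :
    EllTwo s →L[ℂ] EllTwo r :=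
  (toeplitzLin (fun ν : ℕ => fourierMatrix F ν) hF.summable).mkContinuous _
    (norm_toeplitzLin_le hF.summable)

/-- The block entries of the Toeplitz operator, in coordinates. -/
theorem toeplitz_apply {r s : ℕ} (F : Circle → Matrix (Fin r) (Fin s) ℂ) (hF : MemWienerPlus F)
    (x : EllTwo s) (i : ℕ) :
    toeplitz F hF x i = ∑ j ∈ Finset.range (i + 1),
      Matrix.toEuclideanLin (fourierMatrix F ((i - j : ℕ) : ℤ)) (x j) := rfl

end WienerBezout

end

noncomputable section

namespace WienerBezout

/-! Write `T = A A*` with `A` the Toeplitz operator. Strict positivity gives `h > 0` such that `B =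
1 - hT` has norm less than 1 on `ℓ²`, and `x = T⁻¹y` solves `x = Bx + hy`. The point is to make `B`
a contraction also in a norm equivalent to that of `ℓ¹`.

That norm is `localizedNorm`, the sum over `k ∈ ℤ` of the `ℓ²` norms of `wₖx`, where `wₖ(n) =
exp(-ε|n-k|)`. If cutoffs commuted with `B`, the `ℓ²` bound would carry over at once. The
commutators with `A` and `A*` are small when `ε` is small, because `A` is a norm-summable series of
shifts with coefficients and slowly varying weights hardly change under a shift
(`tsum_enorm_commutator_le`, `tendsto_tsum_mul_oscBound`). So `localizedNorm_sub_smul_le` gives a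
rate below 1 for small `ε`, and the Neumann sums for `x` stay bounded in `ℓ¹`
(`mem_ellOne_of_contraction`). -/

/-! ### Exponential weights and cutoff operators. -/

/-- The two-sided exponential weight of rate `|ε|` centred at `k`. -/
def expWeight (ε : ℝ) (k : ℤ) (n : ℕ) : ℝ := Real.exp (-|ε * ((n : ℝ) - k)|)

theorem expWeight_pos (ε : ℝ) (k : ℤ) (n : ℕ) : 0 < expWeight ε k n := Real.exp_pos _

theorem expWeight_le_one (ε : ℝ) (k : ℤ) (n : ℕ) : expWeight ε k n ≤ 1 :=
  Real.exp_le_one_iff.2 (neg_nonpos.2 (abs_nonneg _))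

theorem expWeight_eq_of_add_eq (ε : ℝ) {k l : ℤ} {n j : ℕ} (h : (n : ℤ) + l = j + k) :
    expWeight ε k n = expWeight ε l j := by
  have h' : (n : ℝ) + l = j + k := by exact_mod_cast h
  rw [expWeight, expWeight, show (n : ℝ) - k = j - l by linarith]

theorem expWeight_sub_le_exp_mul (ε : ℝ) (k d : ℤ) (n : ℕ) :
    expWeight ε (k - d) n ≤ Real.exp |ε * d| * expWeight ε k n := by
  rw [expWeight, expWeight, ← Real.exp_add, Real.exp_le_exp]
  have h : |ε * ((n : ℝ) - k)| ≤ |ε * ((n : ℝ) - ((k - d : ℤ) : ℝ))| + |ε * d| := by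
    rw [show ε * ((n : ℝ) - k) = ε * ((n : ℝ) - ((k - d : ℤ) : ℝ)) - ε * d by push_cast; ring]
    exact abs_sub _ _
  linarith

theorem abs_expWeight_sub_sub_le (ε : ℝ) (k d : ℤ) (n : ℕ) :
    |expWeight ε (k - d) n - expWeight ε k n| ≤ (Real.exp |ε * d| - 1) * expWeight ε k n := by
  have h1 := expWeight_sub_le_exp_mul ε k d n
  have h2 := expWeight_sub_le_exp_mul ε (k - d) (-d) n
  rw [sub_neg_eq_add, sub_add_cancel, Int.cast_neg, mul_neg, abs_neg] at h2
  have h3 : 1 ≤ Real.exp |ε * d| := Real.one_le_exp (abs_nonneg _)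
  have h4 := expWeight_pos ε (k - d) n
  rcases le_total (expWeight ε k n) (expWeight ε (k - d) n) with h | h
  · rw [abs_of_nonneg (by linarith)]; linarith
  -- Here `h2` bounds the gap by a multiple of the smaller, translated weight, which is then
  -- replaced by the larger one.
  · rw [abs_of_nonpos (by linarith)]; nlinarith

theorem summable_expWeight {ε : ℝ} (hε : 0 < ε) : Summable fun k : ℤ => expWeight ε k 0 := by
  have key : Summable fun n : ℕ => Real.exp (-|ε * n|) := by
    have : Summable fun n : ℕ => Real.exp (-ε) ^ n :=
      summable_geometric_of_lt_one (Real.exp_pos _).le (Real.exp_lt_one_iff.2 (by linarith))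
    refine this.congr fun n => ?_
    rw [← Real.exp_nat_mul, abs_of_nonneg (by positivity)]
    congr 1
    ring
  refine Summable.of_nat_of_neg (key.congr fun n => ?_) (key.congr fun n => ?_) <;>
    simp [expWeight]

theorem norm_ofReal_smul_le {s : ℕ} {w : ℝ} (h0 : 0 ≤ w) (h1 : w ≤ 1)
    (v : EuclideanSpace ℂ (Fin s)) : ‖(w : ℂ) • v‖ ≤ ‖v‖ := by
  rw [norm_smul, Complex.norm_real, Real.norm_of_nonneg h0]
  exact mul_le_of_le_one_left (norm_nonneg _) h1

/-- Multiplication by the exponential weight centred at `k`, as an operator on `ℓ²₊(ℂˢ)`. -/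
def expCutoff {s : ℕ} (ε : ℝ) (k : ℤ) : EllTwo s →L[ℂ] EllTwo s :=
  LinearMap.mkContinuous
    { toFun := fun x => ⟨fun n => (expWeight ε k n : ℂ) • x n, (lp.memℓp x).mono' fun n =>
        norm_ofReal_smul_le (expWeight_pos ε k n).le (expWeight_le_one ε k n) (x n)⟩
      map_add' := fun x y => lp.ext <| funext fun n =>
        smul_add (expWeight ε k n : ℂ) (x n) (y n)
      map_smul' := fun z x => lp.ext <| funext fun n =>
        smul_comm (expWeight ε k n : ℂ) z (x n) } 1 fun x => by
    rw [one_mul]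
    exact lp.norm_mono two_ne_zero fun n =>
      norm_ofReal_smul_le (expWeight_pos ε k n).le (expWeight_le_one ε k n) (x n)

theorem expCutoff_apply {s : ℕ} (ε : ℝ) (k : ℤ) (x : EllTwo s) (n : ℕ) :
    expCutoff ε k x n = (expWeight ε k n : ℂ) • x n := rfl

theorem adjoint_expCutoff {s : ℕ} (ε : ℝ) (k : ℤ) :
    ContinuousLinearMap.adjoint (expCutoff ε k : EllTwo s →L[ℂ] EllTwo s) = expCutoff ε k := by
  symm
  rw [ContinuousLinearMap.eq_adjoint_iff]
  intro x y
  rw [lp.inner_eq_tsum, lp.inner_eq_tsum]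
  refine tsum_congr fun n => ?_
  rw [expCutoff_apply, expCutoff_apply, inner_smul_left, inner_smul_right, Complex.conj_ofReal]

theorem norm_expCutoff_sub_sub_le {s : ℕ} (ε : ℝ) (k d : ℤ) (x : EllTwo s) :
    ‖expCutoff ε (k - d) x - expCutoff ε k x‖ ≤ (Real.exp |ε * d| - 1) * ‖expCutoff ε k x‖ := by
  have h0 : 0 ≤ Real.exp |ε * d| - 1 := sub_nonneg.2 (Real.one_le_exp (abs_nonneg _))
  rw [← Real.norm_of_nonneg h0, ← Complex.norm_real, ← norm_smul]
  refine lp.norm_mono two_ne_zero fun n => ?_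
  change ‖(expWeight ε (k - d) n : ℂ) • x n - (expWeight ε k n : ℂ) • x n‖
    ≤ ‖((Real.exp |ε * d| - 1 : ℝ) : ℂ) • (expWeight ε k n : ℂ) • x n‖
  rw [← sub_smul, norm_smul, norm_smul, norm_smul, ← mul_assoc, ← Complex.ofReal_sub,
    Complex.norm_real, Complex.norm_real, Complex.norm_real, Real.norm_of_nonneg h0,
    Real.norm_of_nonneg (expWeight_pos ε k n).le]
  exact mul_le_mul_of_nonneg_right (abs_expWeight_sub_sub_le ε k d n) (norm_nonneg _)

/-! ### The localized norm and its equivalence with the `ℓ¹` norm. -/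

/-- The amalgam norm `∑ₖ ‖wₖ x‖₂` over all translates `wₖ` of the exponential weight. -/
def localizedNorm {s : ℕ} (ε : ℝ) (x : EllTwo s) : ℝ≥0∞ := ∑' k : ℤ, ‖expCutoff ε k x‖ₑ

theorem localizedNorm_add_le {s : ℕ} (ε : ℝ) (x y : EllTwo s) :
    localizedNorm ε (x + y) ≤ localizedNorm ε x + localizedNorm ε y := by
  rw [localizedNorm, localizedNorm, localizedNorm, ← ENNReal.tsum_add]
  exact ENNReal.tsum_le_tsum fun k => by rw [map_add]; exact enorm_add_le _ _

/-- Each weight equals 1 at its own centre; the centres outside `ℕ` are dropped. -/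
theorem tsum_enorm_le_localizedNorm {s : ℕ} (ε : ℝ) (x : EllTwo s) :
    ∑' n, ‖x n‖ₑ ≤ localizedNorm ε x := by
  calc ∑' n, ‖x n‖ₑ ≤ ∑' n : ℕ, ‖expCutoff ε (n : ℤ) x‖ₑ := by
        refine ENNReal.tsum_le_tsum fun n => ?_
        rw [enorm_le_iff_norm_le]
        refine le_trans (le_of_eq ?_) (lp.norm_apply_le_norm two_ne_zero _ n)
        simp [expCutoff_apply, expWeight]
    _ ≤ localizedNorm ε x := ENNReal.tsum_comp_le_tsum_of_injective Nat.cast_injective _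

theorem enorm_le_tsum_enorm {s : ℕ} (x : EllTwo s) : ‖x‖ₑ ≤ ∑' n, ‖x n‖ₑ := by
  refine (lp.hasSum_single (by simp) x).enorm_le_of_bounded ENNReal.summable.hasSum fun n => ?_
  rw [enorm_le_iff_norm_le, lp.norm_single (by simp)]

/-- Bounding each `ℓ²` norm by an `ℓ¹` norm and exchanging sums leaves, at each site `n`, the total
weight over all centres. It does not depend on `n`, since the centres run through all of `ℤ`. -/
theorem localizedNorm_ne_top {s : ℕ} {ε : ℝ} (hε : 0 < ε) {x : EllTwo s} (hx : x ∈ ellOne s) :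
    localizedNorm ε x ≠ ∞ := by
  have hx' : ∑' n, ‖x n‖ₑ ≠ ∞ := by
    have h := (memℓp_gen_iff (by simp)).1 (show Memℓp (fun n => x n) 1 from hx)
    simp only [ENNReal.toReal_one, Real.rpow_one] at h
    simpa only [ofReal_norm] using h.tsum_ofReal_ne_top
  have hw : ∑' k : ℤ, ENNReal.ofReal (expWeight ε k 0) ≠ ∞ :=
    (summable_expWeight hε).tsum_ofReal_ne_top
  have hcol : ∀ n : ℕ, ∑' k : ℤ, ENNReal.ofReal (expWeight ε k n)
      = ∑' k : ℤ, ENNReal.ofReal (expWeight ε k 0) := fun n => by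
    rw [← (Equiv.addRight (n : ℤ)).tsum_eq]
    refine tsum_congr fun k => ?_
    rw [expWeight_eq_of_add_eq ε (l := k) (j := 0) (by simp [add_comm])]
  refine ne_top_of_le_ne_top (ENNReal.mul_ne_top hw hx') ?_
  calc localizedNorm ε x ≤ ∑' k : ℤ, ∑' n : ℕ, ENNReal.ofReal (expWeight ε k n) * ‖x n‖ₑ := by
        refine ENNReal.tsum_le_tsum fun k => (enorm_le_tsum_enorm _).trans_eq ?_
        refine tsum_congr fun n => ?_
        rw [expCutoff_apply, enorm_smul, ← ofReal_norm (expWeight ε k n : ℂ), Complex.norm_real,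
          Real.norm_of_nonneg (expWeight_pos ε k n).le]
    _ = _ := by
        rw [ENNReal.tsum_comm, ← ENNReal.tsum_mul_left]
        refine tsum_congr fun n => ?_
        rw [ENNReal.tsum_mul_right, hcol]

theorem tsum_enorm_expCutoff_sub {s : ℕ} (ε : ℝ) (d : ℤ) (x : EllTwo s) :
    ∑' k : ℤ, ‖expCutoff ε (k - d) x‖ₑ = localizedNorm ε x :=
  (Equiv.subRight d).tsum_eq fun k => ‖expCutoff ε k x‖ₑ

/-! ### Commutators of cutoffs with series of shifts. -/

/-- A bound for the relative oscillation of the exponential weight under translation by `d`. -/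
def oscBound (ε : ℝ) (d : ℤ) : ℝ := min 2 (Real.exp |ε * d| - 1)

theorem oscBound_nonneg (ε : ℝ) (d : ℤ) : 0 ≤ oscBound ε d :=
  le_min zero_le_two (sub_nonneg.2 (Real.one_le_exp (abs_nonneg _)))

theorem oscBound_neg (ε : ℝ) (d : ℤ) : oscBound ε (-d) = oscBound ε d := by
  simp [oscBound]

/-- The exponential bound is small for small `ε` but grows too fast in `d` to be summed against a
merely summable sequence. The constant 2, from the triangle inequality and translation invariance,
takes over for large `d`. -/
theorem tsum_enorm_expCutoff_sub_sub_le {s : ℕ} (ε : ℝ) (d : ℤ) (x : EllTwo s) :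
    ∑' k : ℤ, ‖expCutoff ε (k - d) x - expCutoff ε k x‖ₑ
      ≤ ENNReal.ofReal (oscBound ε d) * localizedNorm ε x := by
  rw [oscBound]
  rcases min_choice 2 (Real.exp |ε * d| - 1) with h | h <;> rw [h]
  · calc ∑' k : ℤ, ‖expCutoff ε (k - d) x - expCutoff ε k x‖ₑ
        ≤ ∑' k : ℤ, (‖expCutoff ε (k - d) x‖ₑ + ‖expCutoff ε k x‖ₑ) :=
          ENNReal.tsum_le_tsum fun k => enorm_sub_le
      _ = _ := by
          rw [ENNReal.tsum_add, tsum_enorm_expCutoff_sub, ENNReal.ofReal_ofNat, two_mul]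
          rfl
  · rw [localizedNorm, ← ENNReal.tsum_mul_left]
    refine ENNReal.tsum_le_tsum fun k => ?_
    rw [← ofReal_norm, ← ofReal_norm (expCutoff ε k x),
      ← ENNReal.ofReal_mul (sub_nonneg.2 (Real.one_le_exp (abs_nonneg _)))]
    exact ENNReal.ofReal_le_ofReal (norm_expCutoff_sub_sub_le ε k d x)

theorem localizedNorm_apply_le {r s : ℕ} {ε : ℝ} {V : ℕ → EllTwo s →L[ℂ] EllTwo r} {d : ℕ → ℤ}
    (hV : ∀ ν k, expCutoff ε k ∘L V ν = V ν ∘L expCutoff ε (k - d ν))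
    (hsum : Summable fun ν => ‖V ν‖) {A : EllTwo s →L[ℂ] EllTwo r} (hA : HasSum V A)
    (x : EllTwo s) :
    localizedNorm ε (A x) ≤ ENNReal.ofReal (∑' ν, ‖V ν‖) * localizedNorm ε x := by
  have hk : ∀ k, ‖expCutoff ε k (A x)‖ₑ ≤ ∑' ν, ‖V ν‖ₑ * ‖expCutoff ε (k - d ν) x‖ₑ := by
    intro k
    have h := (hA.mapL (ContinuousLinearMap.apply ℂ _ x)).mapL (expCutoff ε k)
    refine h.enorm_le_of_bounded ENNReal.summable.hasSum fun ν => ?_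
    have h' := DFunLike.congr_fun (hV ν k) x
    simp only [ContinuousLinearMap.comp_apply] at h'
    rw [ContinuousLinearMap.apply_apply, h']
    exact (V ν).le_opENorm _
  calc localizedNorm ε (A x) ≤ ∑' k, ∑' ν, ‖V ν‖ₑ * ‖expCutoff ε (k - d ν) x‖ₑ :=
        ENNReal.tsum_le_tsum hk
    _ = ∑' ν, ‖V ν‖ₑ * localizedNorm ε x := by
        rw [ENNReal.tsum_comm]
        refine tsum_congr fun ν => ?_
        rw [ENNReal.tsum_mul_left, tsum_enorm_expCutoff_sub]
    _ = _ := by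
        rw [ENNReal.tsum_mul_right, ENNReal.ofReal_tsum_of_nonneg (fun _ => norm_nonneg _) hsum]
        simp only [ofReal_norm]

/-- By `hV`, the commutator of `wₖ` with `V ν` is `V ν` applied to the difference of two translated
cutoffs. -/
theorem tsum_enorm_commutator_le {r s : ℕ} {ε : ℝ} {V : ℕ → EllTwo s →L[ℂ] EllTwo r}
    {d : ℕ → ℤ} (hV : ∀ ν k, expCutoff ε k ∘L V ν = V ν ∘L expCutoff ε (k - d ν))
    (hsum : Summable fun ν => ‖V ν‖) {A : EllTwo s →L[ℂ] EllTwo r} (hA : HasSum V A)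
    (x : EllTwo s) :
    ∑' k : ℤ, ‖expCutoff ε k (A x) - A (expCutoff ε k x)‖ₑ
      ≤ ENNReal.ofReal (∑' ν, ‖V ν‖ * oscBound ε (d ν)) * localizedNorm ε x := by
  have hk : ∀ k, ‖expCutoff ε k (A x) - A (expCutoff ε k x)‖ₑ
      ≤ ∑' ν, ‖V ν‖ₑ * ‖expCutoff ε (k - d ν) x - expCutoff ε k x‖ₑ := by
    intro k
    have h := ((hA.mapL (ContinuousLinearMap.apply ℂ _ x)).mapL (expCutoff ε k)).sub
      (hA.mapL (ContinuousLinearMap.apply ℂ _ (expCutoff ε k x)))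
    refine h.enorm_le_of_bounded ENNReal.summable.hasSum fun ν => ?_
    have h' := DFunLike.congr_fun (hV ν k) x
    simp only [ContinuousLinearMap.comp_apply] at h'
    rw [ContinuousLinearMap.apply_apply, ContinuousLinearMap.apply_apply, h', ← map_sub]
    exact (V ν).le_opENorm _
  calc _ ≤ ∑' k : ℤ, ∑' ν, ‖V ν‖ₑ * ‖expCutoff ε (k - d ν) x - expCutoff ε k x‖ₑ :=
        ENNReal.tsum_le_tsum hk
    _ ≤ ∑' ν, ENNReal.ofReal (‖V ν‖ * oscBound ε (d ν)) * localizedNorm ε x := by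
        rw [ENNReal.tsum_comm]
        refine ENNReal.tsum_le_tsum fun ν => ?_
        rw [ENNReal.tsum_mul_left, ENNReal.ofReal_mul (norm_nonneg _), ofReal_norm, mul_assoc]
        exact mul_le_mul_right (tsum_enorm_expCutoff_sub_sub_le ε (d ν) x) _
    _ = _ := by
        rw [ENNReal.tsum_mul_right, ENNReal.ofReal_tsum_of_nonneg
          (fun ν => mul_nonneg (norm_nonneg _) (oscBound_nonneg _ _))]
        refine Summable.of_nonneg_of_le
          (fun ν => mul_nonneg (norm_nonneg _) (oscBound_nonneg _ _)) (fun ν => ?_)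
          (hsum.mul_right 2)
        exact mul_le_mul_of_nonneg_left (min_le_left _ _) (norm_nonneg _)

theorem tendsto_tsum_mul_oscBound {g : ℕ → ℝ} (hg : Summable g) (hg0 : ∀ ν, 0 ≤ g ν)
    (d : ℕ → ℤ) :
    Filter.Tendsto (fun ε : ℝ => ∑' ν, g ν * oscBound ε (d ν)) (nhds 0) (nhds 0) := by
  have h : Filter.Tendsto (fun ε : ℝ => ∑' ν, g ν * oscBound ε (d ν)) (nhds 0)
      (nhds (∑' ν, g ν * oscBound 0 (d ν))) := by
    refine tendsto_tsum_of_dominated_convergence (hg.mul_right 2) (fun ν => ?_)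
      (Filter.Eventually.of_forall fun ε ν => ?_)
    · have : Continuous fun ε : ℝ => g ν * oscBound ε (d ν) := by
        unfold oscBound
        fun_prop
      exact this.tendsto 0
    · rw [Real.norm_of_nonneg (mul_nonneg (hg0 ν) (oscBound_nonneg _ _))]
      exact mul_le_mul_of_nonneg_left (min_le_left _ _) (hg0 ν)
  simpa [oscBound] using h

/-- Moving `wₖ` past `B` costs `h` times `[wₖ, A]A* + A[wₖ, A*]`. Each of the two terms contributes
the product of the two series, whence the factor 2. -/
theorem localizedNorm_sub_smul_le {r s : ℕ} {ε : ℝ} {V : ℕ → EllTwo s →L[ℂ] EllTwo r}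
    {d : ℕ → ℤ} (hV : ∀ ν k, expCutoff ε k ∘L V ν = V ν ∘L expCutoff ε (k - d ν))
    (hsum : Summable fun ν => ‖V ν‖) {A : EllTwo s →L[ℂ] EllTwo r} (hA : HasSum V A)
    {h : ℝ} (hh : 0 ≤ h) (x : EllTwo r) :
    localizedNorm ε ((1 - (h : ℂ) • (A ∘L ContinuousLinearMap.adjoint A)) x)
      ≤ ENNReal.ofReal (‖1 - (h : ℂ) • (A ∘L ContinuousLinearMap.adjoint A)‖
          + 2 * h * (∑' ν, ‖V ν‖) * ∑' ν, ‖V ν‖ * oscBound ε (d ν)) * localizedNorm ε x := by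
  set A' := ContinuousLinearMap.adjoint A with hA'def
  set B := 1 - (h : ℂ) • (A ∘L A') with hB
  set γ := ∑' ν, ‖V ν‖
  set η := ∑' ν, ‖V ν‖ * oscBound ε (d ν)
  have hγ0 : 0 ≤ γ := tsum_nonneg fun _ => norm_nonneg _
  have hη0 : 0 ≤ η := tsum_nonneg fun _ => mul_nonneg (norm_nonneg _) (oscBound_nonneg _ _)
  have hAγ : ‖A‖ₑ ≤ ENNReal.ofReal γ := by
    rw [← ofReal_norm]
    exact ENNReal.ofReal_le_ofReal (hA.norm_le_of_bounded hsum.hasSum fun _ => le_rfl)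
  have hV' : ∀ ν k, expCutoff ε k ∘L ContinuousLinearMap.adjoint (V ν)
      = ContinuousLinearMap.adjoint (V ν) ∘L expCutoff ε (k - -d ν) := by
    intro ν k
    -- Cutoffs are self-adjoint, so taking adjoints reverses the shift; the centre `k + d ν` makes
    -- the indices match.
    have h1 := congrArg ContinuousLinearMap.adjoint (hV ν (k + d ν))
    rw [ContinuousLinearMap.adjoint_comp, ContinuousLinearMap.adjoint_comp, adjoint_expCutoff,
      adjoint_expCutoff, add_sub_cancel_right] at h1
    rw [sub_neg_eq_add, h1]
  have hA' : HasSum (fun ν => ContinuousLinearMap.adjoint (V ν)) A' :=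
    hA.map ContinuousLinearMap.adjoint ContinuousLinearMap.adjoint.continuous
  have hsum' : Summable fun ν => ‖ContinuousLinearMap.adjoint (V ν)‖ := by
    simpa only [LinearIsometryEquiv.norm_map] using hsum
  have hcomm := tsum_enorm_commutator_le hV hsum hA (A' x)
  have hcomm' := tsum_enorm_commutator_le hV' hsum' hA' x
  have hN' := localizedNorm_apply_le hV' hsum' hA' x
  simp only [LinearIsometryEquiv.norm_map, oscBound_neg] at hcomm' hN'
  have hk : ∀ k, ‖expCutoff ε k (B x)‖ₑ ≤ ‖B‖ₑ * ‖expCutoff ε k x‖ₑ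
      + ‖(h : ℂ)‖ₑ * (‖expCutoff ε k (A (A' x)) - A (expCutoff ε k (A' x))‖ₑ
        + ‖A‖ₑ * ‖expCutoff ε k (A' x) - A' (expCutoff ε k x)‖ₑ) := by
    intro k
    have e : expCutoff ε k (B x) = B (expCutoff ε k x)
        - (h : ℂ) • ((expCutoff ε k (A (A' x)) - A (expCutoff ε k (A' x)))
          + A (expCutoff ε k (A' x) - A' (expCutoff ε k x))) := by
      simp only [hB, sub_apply, one_apply_eq_self,
        smul_apply, ContinuousLinearMap.comp_apply, map_sub, map_smul]
      module
    rw [e]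
    refine enorm_sub_le.trans (add_le_add (B.le_opENorm _) ?_)
    rw [enorm_smul]
    exact mul_le_mul_right
      ((enorm_add_le _ _).trans (add_le_add le_rfl (A.le_opENorm _))) _
  calc localizedNorm ε (B x)
      ≤ _ := ENNReal.tsum_le_tsum hk
    _ = ‖B‖ₑ * localizedNorm ε x
        + ‖(h : ℂ)‖ₑ * (∑' k, ‖expCutoff ε k (A (A' x)) - A (expCutoff ε k (A' x))‖ₑ
        + ‖A‖ₑ * ∑' k, ‖expCutoff ε k (A' x) - A' (expCutoff ε k x)‖ₑ) := by
        rw [ENNReal.tsum_add, ENNReal.tsum_mul_left, ENNReal.tsum_mul_left, ENNReal.tsum_add,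
          ENNReal.tsum_mul_left]
        rfl
    _ ≤ ‖B‖ₑ * localizedNorm ε x
        + ‖(h : ℂ)‖ₑ * (ENNReal.ofReal η * (ENNReal.ofReal γ * localizedNorm ε x)
        + ENNReal.ofReal γ * (ENNReal.ofReal η * localizedNorm ε x)) := by
        gcongr
        exact hcomm.trans (mul_le_mul_right hN' _)
    _ = _ := by
        rw [← ofReal_norm B, ← ofReal_norm (h : ℂ), Complex.norm_real, Real.norm_of_nonneg hh,
          ENNReal.ofReal_add (norm_nonneg _) (by positivity), ENNReal.ofReal_mul (by positivity),
          ENNReal.ofReal_mul (by positivity), ENNReal.ofReal_mul (by positivity),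
          ENNReal.ofReal_ofNat]
        ring

/-! ### Neumann iteration in `ℓ²` and `ℓ¹`. -/

/-- From `δ ≤ T ≤ ‖T‖` and `h = 1/(‖T‖ + δ)` it follows that `0 ≤ 1 - hT ≤ 1 - hδ`. -/
theorem _root_.IsStrictlyPositive.exists_norm_one_sub_smul_lt_one {H : Type*}
    [NormedAddCommGroup H] [InnerProductSpace ℂ H] [CompleteSpace H] {T : H →L[ℂ] H}
    (hT : IsStrictlyPositive T) : ∃ h : ℝ, 0 < h ∧ ‖1 - (h : ℂ) • T‖ < 1 := by
  rcases subsingleton_or_nontrivial (H →L[ℂ] H) with _ | _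
  · exact ⟨1, one_pos, by rw [Subsingleton.elim (1 - _) (0 : H →L[ℂ] H), norm_zero]; exact one_pos⟩
  obtain ⟨δ, hδ, hle⟩ : ∃ δ > 0, algebraMap ℝ (H →L[ℂ] H) δ ≤ T :=
    (CFC.exists_pos_algebraMap_le_iff hT.isSelfAdjoint).2 fun x hx => hT.spectrum_pos hx
  obtain ⟨h, hh, hle1, hδ1⟩ : ∃ h : ℝ, 0 < h ∧ h * ‖T‖ ≤ 1 ∧ h * δ ≤ 1 := by
    refine ⟨(‖T‖ + δ)⁻¹, by positivity, ?_, ?_⟩ <;>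
    · rw [inv_mul_le_iff₀ (by positivity)]
      have := norm_nonneg T
      linarith
  have hcast : (h : ℂ) • T = h • T := Complex.coe_smul h T
  refine ⟨h, hh, ?_⟩
  rw [hcast]
  have hup : T ≤ algebraMap ℝ (H →L[ℂ] H) ‖T‖ :=
    (CStarAlgebra.norm_le_iff_le_algebraMap T (norm_nonneg T) hT.nonneg).1 le_rfl
  have h0 : 0 ≤ 1 - h • T := by
    rw [sub_nonneg]
    calc h • T ≤ h • algebraMap ℝ (H →L[ℂ] H) ‖T‖ := smul_le_smul_of_nonneg_left hup hh.le
      _ = algebraMap ℝ (H →L[ℂ] H) (h * ‖T‖) := by rw [map_mul, Algebra.smul_def]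
      _ ≤ algebraMap ℝ (H →L[ℂ] H) 1 := algebraMap_mono _ hle1
      _ = 1 := map_one _
  refine lt_of_le_of_lt ((CStarAlgebra.norm_le_iff_le_algebraMap _ (sub_nonneg.2 hδ1) h0).2 ?_)
    (sub_lt_self 1 (mul_pos hh hδ))
  rw [map_sub, map_one, map_mul, ← Algebra.smul_def]
  exact sub_le_sub_left (smul_le_smul_of_nonneg_left hle hh.le) _

/-- The localized norm of `x` is not known to be finite, so `hN` cannot be absorbed directly. It is
applied to the Neumann sums `x - Bⁿx`, which converge to `x` in `ℓ²`; finite coordinate sums then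
pass to the limit. -/
theorem mem_ellOne_of_contraction {s : ℕ} {ε : ℝ} (hε : 0 < ε) {B : EllTwo s →L[ℂ] EllTwo s}
    (hB : ‖B‖ < 1) {q : ℝ} (hq0 : 0 ≤ q) (hq : q < 1)
    (hN : ∀ x, localizedNorm ε (B x) ≤ ENNReal.ofReal q * localizedNorm ε x)
    {x y : EllTwo s} (hy : y ∈ ellOne s) (hxy : x = B x + y) : x ∈ ellOne s := by
  -- `C` is the fixed point of `t ↦ qt + localizedNorm ε y`, so the bound reproduces itself in the
  -- induction.
  set C : ℝ := (localizedNorm ε y).toReal / (1 - q)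
  have hC0 : 0 ≤ C := div_nonneg ENNReal.toReal_nonneg (by linarith)
  have hyC : localizedNorm ε y = ENNReal.ofReal ((1 - q) * C) := by
    rw [mul_div_cancel₀ _ (by linarith), ENNReal.ofReal_toReal (localizedNorm_ne_top hε hy)]
  have hbound : ∀ n : ℕ, localizedNorm ε (x - (B ^ n) x) ≤ ENNReal.ofReal C := by
    intro n
    induction n with
    | zero => simp [localizedNorm]
    | succ n ih =>
      have e : x - (B ^ (n + 1)) x = B (x - (B ^ n) x) + y := by
        rw [pow_succ', mul_apply_eq_comp, map_sub]
        nth_rw 1 [hxy]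
        abel
      rw [e]
      calc _ ≤ ENNReal.ofReal q * ENNReal.ofReal C + ENNReal.ofReal ((1 - q) * C) :=
            (localizedNorm_add_le _ _ _).trans
              (add_le_add ((hN _).trans (mul_le_mul_right ih _)) hyC.le)
        _ = ENNReal.ofReal C := by
            rw [← ENNReal.ofReal_mul hq0, ← ENNReal.ofReal_add (by positivity)
              (mul_nonneg (by linarith) hC0)]
            ring_nf
  have hlim : Filter.Tendsto (fun n : ℕ => x - (B ^ n) x) Filter.atTop (nhds x) := by
    have h1 := ((ContinuousLinearMap.apply ℂ (EllTwo s) x).continuous.tendsto 0).comp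
      (tendsto_pow_atTop_nhds_zero_of_norm_lt_one hB)
    simpa using (tendsto_const_nhds (x := x)).sub h1
  refine memℓp_gen' (C := C) fun t => ?_
  simp only [ENNReal.toReal_one, Real.rpow_one]
  have hfin : Filter.Tendsto (fun n : ℕ => ∑ i ∈ t, ‖(x - (B ^ n) x) i‖) Filter.atTop
      (nhds (∑ i ∈ t, ‖x i‖)) :=
    tendsto_finsetSum t fun i _ =>
      (((lp.evalCLM ℂ (fun _ : ℕ => EuclideanSpace ℂ (Fin s)) 2 i).continuous.tendsto x).comp
        hlim).norm
  refine le_of_tendsto' hfin fun n => ?_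
  rw [← ENNReal.ofReal_le_ofReal_iff hC0, ENNReal.ofReal_sum_of_nonneg fun _ _ => norm_nonneg _]
  simp only [ofReal_norm]
  exact (ENNReal.sum_le_tsum t).trans ((tsum_enorm_le_localizedNorm ε _).trans (hbound n))

theorem mapsTo_inverse_ellOne {r s : ℕ} {V : ℕ → EllTwo s →L[ℂ] EllTwo r} {d : ℕ → ℤ}
    (hV : ∀ (ε : ℝ) ν k, expCutoff ε k ∘L V ν = V ν ∘L expCutoff ε (k - d ν))
    (hsum : Summable fun ν => ‖V ν‖) {A : EllTwo s →L[ℂ] EllTwo r} (hA : HasSum V A)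
    (hpos : IsStrictlyPositive (A ∘L ContinuousLinearMap.adjoint A)) :
    Set.MapsTo (ContinuousLinearMap.inverse (A ∘L ContinuousLinearMap.adjoint A))
      (ellOne r) (ellOne r) := by
  intro y hy
  obtain ⟨h, hh, hlt⟩ := hpos.exists_norm_one_sub_smul_lt_one
  have hN := fun ε => localizedNorm_sub_smul_le (hV ε) hsum hA hh.le
  set T := A ∘L ContinuousLinearMap.adjoint A
  have hT : T (T.inverse y) = y := by
    rw [← ContinuousLinearMap.ringInverse_eq_inverse, ← mul_apply_eq_comp,
      Ring.mul_inverse_cancel T hpos.isUnit, one_apply_eq_self]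
  have hlim := ((tendsto_tsum_mul_oscBound hsum (fun ν => norm_nonneg (V ν)) d).const_mul
    (2 * h * ∑' ν, ‖V ν‖)).const_add ‖1 - (h : ℂ) • T‖
  rw [mul_zero, add_zero] at hlim
  -- The limit is taken at 0, but `ε` must be positive for the weights to be summable.
  obtain ⟨ε, hεlt, hε⟩ := (((hlim.eventually_lt_const hlt).filter_mono
    nhdsWithin_le_nhds).and (self_mem_nhdsWithin (s := Set.Ioi (0 : ℝ)))).exists
  have hq0 : 0 ≤ 2 * h * (∑' ν, ‖V ν‖) * ∑' ν, ‖V ν‖ * oscBound ε (d ν) :=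
    mul_nonneg (mul_nonneg (by positivity) (tsum_nonneg fun _ => norm_nonneg _))
      (tsum_nonneg fun _ => mul_nonneg (norm_nonneg _) (oscBound_nonneg _ _))
  refine mem_ellOne_of_contraction hε hlt (add_nonneg (norm_nonneg _) hq0) hεlt (hN ε)
    (y := (h : ℂ) • y) (Memℓp.const_smul hy (h : ℂ)) ?_
  rw [sub_apply, one_apply_eq_self, smul_apply, hT, sub_add_cancel]

/-! ### Block diagonals of the Toeplitz operator. -/

/-- The operator on `ℓ²₊` given by a single block diagonal of a Toeplitz operator: the shift by
`ν` places followed by the matrix `a`. -/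
def toeplitzDiagonal {r s : ℕ} (ν : ℕ) (a : Matrix (Fin r) (Fin s) ℂ) :
    EllTwo s →L[ℂ] EllTwo r :=
  have hc : Summable fun n => ‖(Pi.single ν a : ℕ → Matrix (Fin r) (Fin s) ℂ) n‖ :=
    summable_of_ne_finset_zero (s := {ν}) fun n hn => by
      rw [Pi.single_eq_of_ne (by simpa using hn), norm_zero]
  (toeplitzLin (Pi.single ν a) hc).mkContinuous _ (norm_toeplitzLin_le hc)

theorem toeplitzDiagonal_apply {r s : ℕ} (ν : ℕ) (a : Matrix (Fin r) (Fin s) ℂ) (x : EllTwo s)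
    (i : ℕ) : toeplitzDiagonal ν a x i = ∑ j ∈ Finset.range (i + 1),
      Matrix.toEuclideanLin ((Pi.single ν a : ℕ → Matrix (Fin r) (Fin s) ℂ) (i - j)) (x j) := rfl

theorem norm_toeplitzDiagonal_le {r s : ℕ} (ν : ℕ) (a : Matrix (Fin r) (Fin s) ℂ) :
    ‖toeplitzDiagonal ν a‖ ≤ ‖a‖ := by
  have h : ∑' n, ‖(Pi.single ν a : ℕ → Matrix (Fin r) (Fin s) ℂ) n‖ = ‖a‖ := by
    rw [tsum_eq_single ν, Pi.single_eq_same]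
    intro n hn
    rw [Pi.single_eq_of_ne hn, norm_zero]
  rw [← h]
  exact LinearMap.mkContinuous_norm_le _ (h ▸ norm_nonneg a) (norm_toeplitzLin_le _)

theorem expCutoff_comp_toeplitzDiagonal {r s : ℕ} (ε : ℝ) (ν : ℕ)
    (a : Matrix (Fin r) (Fin s) ℂ) (k : ℤ) :
    expCutoff ε k ∘L toeplitzDiagonal ν a
      = toeplitzDiagonal ν a ∘L expCutoff ε (k - (ν : ℤ)) := by
  ext1 x
  refine lp.ext (funext fun i => ?_)
  rw [ContinuousLinearMap.comp_apply, ContinuousLinearMap.comp_apply, expCutoff_apply,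
    toeplitzDiagonal_apply, toeplitzDiagonal_apply, Finset.smul_sum]
  refine Finset.sum_congr rfl fun j hj => ?_
  rw [expCutoff_apply, map_smul]
  -- Only entries with `i = j + ν` survive, and there `i - k = j - (k - ν)`, so the two weights
  -- agree.
  by_cases hν : i - j = ν
  · rw [expWeight_eq_of_add_eq ε (l := k - ν) (j := j)]
    have := Finset.mem_range.1 hj
    omega
  · rw [Pi.single_eq_of_ne hν]
    simp

theorem hasSum_toeplitzDiagonal {r s : ℕ} (F : Circle → Matrix (Fin r) (Fin s) ℂ)
    (hF : MemWienerPlus F) :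
    HasSum (fun ν : ℕ => toeplitzDiagonal ν (fourierMatrix F ν)) (toeplitz F hF) := by
  have hs : Summable fun ν : ℕ => toeplitzDiagonal ν (fourierMatrix F ν) :=
    Summable.of_norm_bounded hF.summable fun ν => norm_toeplitzDiagonal_le ν _
  convert hs.hasSum
  ext1 x
  refine lp.ext (funext fun i => ?_)
  have h1 := (hs.hasSum.mapL (ContinuousLinearMap.apply ℂ _ x)).mapL
    (lp.evalCLM ℂ (fun _ : ℕ => EuclideanSpace ℂ (Fin r)) 2 i)
  refine HasSum.unique ?_ h1
  change HasSum (fun ν : ℕ => toeplitzDiagonal ν (fourierMatrix F ν) x i) _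
  simp only [toeplitzDiagonal_apply]
  rw [toeplitz_apply]
  refine hasSum_sum fun j _ => ?_
  convert hasSum_single (i - j) fun ν hν => ?_ using 1
  · rw [Pi.single_eq_same]
  · rw [Pi.single_eq_of_ne hν.symm, map_zero, LinearMap.zero_apply]

end WienerBezout
end

theorem lemma3p1 (m p : ℕ) (G : Circle → Matrix (Fin m) (Fin p) ℂ)
    (hG : WienerBezout.MemWienerPlus G)
    (hpos : IsStrictlyPositive
      (WienerBezout.toeplitz G hG ∘L ContinuousLinearMap.adjoint (WienerBezout.toeplitz G hG))) :
    Set.MapsTo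
      (ContinuousLinearMap.inverse
        (WienerBezout.toeplitz G hG ∘L ContinuousLinearMap.adjoint (WienerBezout.toeplitz G hG)))
      (WienerBezout.ellOne m) (WienerBezout.ellOne m) :=
  WienerBezout.mapsTo_inverse_ellOne
    (fun ε ν k => WienerBezout.expCutoff_comp_toeplitzDiagonal ε ν _ k)
    (Summable.of_nonneg_of_le (fun _ => norm_nonneg _)
      (fun ν => WienerBezout.norm_toeplitzDiagonal_le ν _) hG.summable)
    (WienerBezout.hasSum_toeplitzDiagonal G hG) hpos
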